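/- Let $\mathfrak{H}$ be a complex Hilbert space with identity operator $I$, and let $\mathcal{A}$ be a unital $C^*$-subalgebra of $B(\mathfrak{H})$, that is, a norm-closed $*$-subalgebra of $B(\mathfrak{H})$ containing $I$. Let $D, E, F, G, H : \mathcal{A} \to B(\mathfrak{H})$ be linear maps such that $D$ is a $*$-$(E,F,G,H)$-derivation, i.e. $$D(ab) = E(a)F(b) + G(a)H(b) \qquad (a, b \in \mathcal{A}),$$ and each $T \in \{D,E,F,G,H\}$ is a $*$-mapping, i.e. $T(a^*) = T(a)^*$ for all $a \in \mathcal{A}$. A map $T : \mathcal{A} \to B(\mathfrak{H})$ is called $D$-continuous if $\lim_{x \to 0} T(x)D(b) = 0$ and $\lim_{x\to 0} D(b)T(x) = 0$ (in norm) for every $b \in \mathcal{A}$. Then the following hold. (i) If $E(I) = H(I) = I$, $H(a)D(I)E(b) = -E(a)D(I)H(b)$ for all $a, b \in \mathcal{A}$, and $E + H$ is $D$-continuous, then $D$ is continuous. (ii) If $F(I) = G(I) = I$, $G(a)D(I)F(b) = -F(a)D(I)G(b)$ for all $a, b \in \mathcal{A}$, and $F + G$ is $D$-continuous, then $D$ is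 continuous. -/

import Mathlib

/-- `D` is an `(E, F, G, H)`-derivation: `D, E, F, G, H` are linear maps between two algebras with
`D (a b) = E a F b + G a H b` for all `a, b`. -/
def IsEFGHDerivation {A B : Type*} [NonUnitalRing A] [Module ℂ A] [NonUnitalRing B] [Module ℂ B]
    (D E F G H : A →ₗ[ℂ] B) : Prop :=
  ∀ a b : A, D (a * b) = E a * F b + G a * H b

/-- A `∗`-mapping: a map that preserves the involution. -/
def IsStarMapping {A B : Type*} [Star A] [Star B] (T : A → B) : Prop :=
  ∀ a : A, T (star a) = star (T a)

/-- `D` is a `∗`-`(E, F, G, H)`-derivation: an `(E, F, G, H)`-derivation for which all five maps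
are `∗`-mappings. -/
structure IsStarEFGHDerivation {A B : Type*} [NonUnitalRing A] [Module ℂ A] [Star A]
    [NonUnitalRing B] [Module ℂ B] [Star B] (D E F G H : A →ₗ[ℂ] B) : Prop where
  derivation : IsEFGHDerivation D E F G H
  star_D : IsStarMapping D
  star_E : IsStarMapping E
  star_F : IsStarMapping F
  star_G : IsStarMapping G
  star_H : IsStarMapping H

/-- `T` is left `S`-continuous: `T x * S b → 0` as `x → 0`, for every `b`. -/
def IsLeftContinuousRel {A B : Type*} [NonUnitalNormedRing A] [NonUnitalNormedRing B]
    (T S : A → B) : Prop :=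
  ∀ b : A, Filter.Tendsto (fun x : A => T x * S b) (nhds 0) (nhds 0)

/-- `T` is right `S`-continuous: `S b * T x → 0` as `x → 0`, for every `b`. -/
def IsRightContinuousRel {A B : Type*} [NonUnitalNormedRing A] [NonUnitalNormedRing B]
    (T S : A → B) : Prop :=
  ∀ b : A, Filter.Tendsto (fun x : A => S b * T x) (nhds 0) (nhds 0)

/-- `T` is `S`-continuous: it is both left and right `S`-continuous. -/
def IsContinuousRel {A B : Type*} [NonUnitalNormedRing A] [NonUnitalNormedRing B]
    (T S : A → B) : Prop :=
  IsLeftContinuousRel T S ∧ IsRightContinuousRel T S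

/-! Since `D 1 = 0`, the identity becomes `D (a b) = E a D b + D a H b` in case (i), and likewise
with `G`, `F` in (ii). Averaging with its adjoint makes `D` a derivation along one `*`-mapping `S`,
half the sum. `D`-continuity gives `S a T = lim D (a xₙ)` for `T = lim D xₙ`, `xₙ → 0`, so `S` is
multiplicative on the separating space. On the closed span `K` of the ranges of such `T`, `S`
restricts to a `*`-homomorphism `π`, and the compression `d` of `D` to `K` is a derivation along
`π`.

If `x ↦ d (a x)` is continuous, then `π a = 0`. A gliding hump then rules out infinite orthogonal
families in the range of `π`, so `1` is a combination of minimal projections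
(`one_mem_span_minimal`). Corners between these are at most one-dimensional and `d` kills `ker π`,
so `d` is continuous. Hence every `T` compresses to zero, so `T = 0`, and the closed graph theorem
applies. -/

section Auxiliary

open Filter Topology

/-- `d` is a derivation along `S`: `d (a b) = S a d b + d a S b` for all `a`, `b`. -/
def IsDerivationAlong {A B : Type*} [NonUnitalRing A] [NonUnitalRing B] (S d : A → B) : Prop :=
  ∀ a b : A, d (a * b) = S a * d b + d a * S b

theorem LinearMap.exists_norm_le_lt_norm_of_not_continuous {A C : Type*} [NormedAddCommGroup A]
    [NormedSpace ℂ A] [NormedAddCommGroup C] [NormedSpace ℂ C] {f : A →ₗ[ℂ] C}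
    (hf : ¬ Continuous f) {ε : ℝ} (hε : 0 < ε) (M : ℝ) : ∃ x, ‖x‖ ≤ ε ∧ M < ‖f x‖ := by
  by_contra! h
  apply hf
  obtain ⟨k, hk⟩ := f.bound_of_ball_bound hε M (fun z hz ↦ h z (mem_ball_zero_iff.mp hz).le)
  exact AddMonoidHomClass.continuous_of_bound f k hk

/-! ### Derivations along a `*`-homomorphism -/

section StarHom

variable {A C : Type*} [CStarAlgebra A] [CStarAlgebra C] {π : A →⋆ₐ[ℂ] C} {d : A →ₗ[ℂ] C}

theorem StarAlgHom.continuous_of_cstar (π : A →⋆ₐ[ℂ] C) : Continuous π :=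
  AddMonoidHomClass.continuous_of_bound π 1 fun a ↦ by
    simpa using NonUnitalStarAlgHom.norm_apply_le π a

theorem StarAlgHom.map_cfc_of_isSelfAdjoint (π : A →⋆ₐ[ℂ] C) {f : ℝ → ℝ} (hf : Continuous f)
    {a : A} (ha : IsSelfAdjoint a) : π (cfc f a) = cfc f (π a) :=
  StarAlgHom.map_cfc π f a (hf.continuousOn) π.continuous_of_cstar ha (ha.map π)

theorem IsDerivationAlong.eq_zero_of_isSelfAdjoint (hd : IsDerivationAlong π d) {a : A}
    (ha : IsSelfAdjoint a) (h : π a = 0) : d a = 0 := by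
  -- `√` is zero on negatives, so this is `t = (√t⁺ + √t⁻)(√t⁺ - √t⁻)`. Both factors vanish at `0`,
  -- so `π` kills both and the Leibniz rule kills `d a`.
  have hmul : a = cfc (fun t : ℝ ↦ √t + √(-t)) a * cfc (fun t : ℝ ↦ √t - √(-t)) a := by
    rw [← cfc_mul _ _ a (by fun_prop) (by fun_prop)]
    conv_lhs => rw [← cfc_id ℝ a]
    congr 1
    ext t
    rcases le_total 0 t with ht | ht
    · simp [Real.sqrt_eq_zero_of_nonpos (neg_nonpos.mpr ht), ht]
    · have := Real.mul_self_sqrt (neg_nonneg.mpr ht)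
      simp [Real.sqrt_eq_zero_of_nonpos ht, this]
  rw [hmul, hd, π.map_cfc_of_isSelfAdjoint (by fun_prop) ha,
    π.map_cfc_of_isSelfAdjoint (by fun_prop) ha, h]
  simp [cfc_apply_zero]

theorem IsDerivationAlong.eq_zero (hd : IsDerivationAlong π d) {a : A} (h : π a = 0) :
    d a = 0 := by
  have hre : d (realPart a : A) = 0 := hd.eq_zero_of_isSelfAdjoint (realPart a).2 (by
    rw [realPart_apply_coe, RCLike.real_smul_eq_coe_smul (K := ℂ), map_smul, map_add, map_star, h]
    simp)
  have him : d (imaginaryPart a : A) = 0 := hd.eq_zero_of_isSelfAdjoint (imaginaryPart a).2 (by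
    rw [imaginaryPart_apply_coe, RCLike.real_smul_eq_coe_smul (K := ℂ), map_smul, map_smul, map_sub,
      map_star, h]
    simp)
  rw [← realPart_add_I_smul_imaginaryPart a]
  simp [hre, him]

theorem IsDerivationAlong.eq_of_map_eq (hd : IsDerivationAlong π d) {a b : A} (h : π a = π b) :
    d a = d b := by
  rw [← sub_eq_zero, ← map_sub]
  exact hd.eq_zero (by simp [h])

/-- A gliding hump argument: if `x ↦ d (a x)` is discontinuous whenever `π a ≠ 0`, then the range
of `π` contains no infinite sequence of pairwise orthogonal nonzero self-adjoint elements. -/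
theorem IsDerivationAlong.not_exists_orthogonal (hd : IsDerivationAlong π d)
    (hπ : ∀ a : A, Continuous (fun x ↦ d (a * x)) → π a = 0) (a : ℕ → A)
    (hsa : ∀ j, IsSelfAdjoint (π (a j))) (hne : ∀ j, π (a j) ≠ 0)
    (horth : ∀ j k, j ≠ k → π (a j) * π (a k) = 0) : False := by
  -- For `c = ∑ aₖ bₖ`, orthogonality gives `π (aⱼ c) = π (aⱼ² bⱼ)`, while `‖d (aⱼ c)‖ ≤ ‖aⱼ‖ ‖d c‖
  -- + 2 ‖d aⱼ‖`. The lower bound contradicts this once `j > ‖d c‖`.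
  have key : ∀ j : ℕ, ∃ b : A, ‖a j * b‖ ≤ (1 / 2) ^ j ∧
      ‖d (a j)‖ * 2 + j * ‖a j‖ < ‖d (a j * a j * b)‖ := by
    intro j
    have hnc : ¬ Continuous (d ∘ₗ LinearMap.mulLeft ℂ (a j * a j)) := by
      intro hc
      have h0 := hπ (a j * a j) hc
      rw [map_mul] at h0
      nth_rewrite 1 [← (hsa j).star_eq] at h0
      exact hne j (CStarRing.star_mul_self_eq_zero_iff _ |>.mp h0)
    obtain ⟨b, hb, hb'⟩ := LinearMap.exists_norm_le_lt_norm_of_not_continuous hnc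
      (ε := (1 / 2) ^ j / (‖a j‖ + 1)) (by positivity) (‖d (a j)‖ * 2 + j * ‖a j‖)
    refine ⟨b, ?_, by simpa only [LinearMap.comp_apply, LinearMap.mulLeft_apply] using hb'⟩
    have hpos : 0 < ‖a j‖ + 1 := by positivity
    rw [le_div_iff₀ hpos] at hb
    calc ‖a j * b‖ ≤ ‖a j‖ * ‖b‖ := norm_mul_le _ _
      _ ≤ ‖b‖ * (‖a j‖ + 1) := by nlinarith [norm_nonneg b]
      _ ≤ _ := hb
  choose b hb hb' using key
  have hsum : Summable fun j ↦ a j * b j := Summable.of_norm_bounded summable_geometric_two hb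
  set c := ∑' j, a j * b j with hc
  have hcn : ‖c‖ ≤ 2 := tsum_of_norm_bounded hasSum_geometric_two hb
  obtain ⟨j, hj⟩ := exists_nat_gt ‖d c‖
  have hπc : π (a j * c) = π (a j * a j * b j) := by
    have hsum' := hsum.map π π.continuous_of_cstar
    rw [map_mul, hc, (hsum.hasSum.map π π.continuous_of_cstar).tsum_eq.symm,
      ← hsum'.tsum_mul_left, tsum_eq_single j]
    · simp [mul_assoc]
    · intro k hk
      simp [← mul_assoc, horth j k hk.symm]
  have h1 : ‖d (a j * c)‖ ≤ ‖a j‖ * ‖d c‖ + ‖d (a j)‖ * 2 := by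
    rw [hd]
    refine (norm_add_le _ _).trans (add_le_add ((norm_mul_le _ _).trans ?_)
      ((norm_mul_le _ _).trans ?_))
    · gcongr
      exact NonUnitalStarAlgHom.norm_apply_le π _
    · gcongr
      exact (NonUnitalStarAlgHom.norm_apply_le π _).trans hcn
  rw [hd.eq_of_map_eq hπc] at h1
  have h2 := hb' j
  nlinarith [norm_nonneg (a j)]

/-- An infinite spectrum contains infinitely many disjoint nonempty open sets; functions supported
on them yield forbidden orthogonal elements. -/
theorem IsDerivationAlong.finite_spectrum (hd : IsDerivationAlong π d)
    (hπ : ∀ a : A, Continuous (fun x ↦ d (a * x)) → π a = 0) {a : A} (ha : IsSelfAdjoint a) :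
    (spectrum ℝ (π a)).Finite := by
  by_contra hinf
  have : Infinite (spectrum ℝ (π a)) := Set.infinite_coe_iff.mpr hinf
  obtain ⟨U, hUi, hUo, hUd⟩ := exists_seq_infinite_isOpen_pairwise_disjoint (spectrum ℝ (π a))
  have hπa : IsSelfAdjoint (π a) := ha.map π
  set V : ℕ → Set ℝ := fun n ↦ Subtype.val '' (U n)ᶜ with hV
  have hVc : ∀ n, IsClosed (V n) := fun n ↦
    (spectrum.isClosed (𝕜 := ℝ) (π a)).isClosedEmbedding_subtypeVal.isClosedMap _
      (hUo n).isClosed_compl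
  -- Needed because `Metric.infDist` to the empty set is `0` by convention.
  have hVne : ∀ n, (V n).Nonempty := by
    intro n
    obtain ⟨x, hx⟩ := (hUi (n + 1)).nonempty
    exact ⟨x, x, fun h ↦ Set.disjoint_left.mp (hUd (show n ≠ n + 1 by simp)) h hx, rfl⟩
  set f : ℕ → ℝ → ℝ := fun n t ↦ Metric.infDist t (V n) with hf
  have hfc : ∀ n, Continuous (f n) := fun n ↦ Metric.continuous_infDist_pt _
  have hmap : ∀ n, π (cfc (f n) a) = cfc (f n) (π a) := fun n ↦
    π.map_cfc_of_isSelfAdjoint (hfc n) ha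
  refine hd.not_exists_orthogonal hπ (fun n ↦ cfc (f n) a) ?_ ?_ ?_
  · intro n
    rw [hmap]
    exact cfc_predicate (f n) (π a)
  · intro n h0
    rw [hmap] at h0
    obtain ⟨x, hx⟩ := (hUi n).nonempty
    have hz : f n x = 0 := by
      have := eqOn_of_cfc_eq_cfc (h0.trans (cfc_const_zero ℝ (π a)).symm)
        (hfc n).continuousOn continuousOn_const hπa
      exact this x.2
    have : (x : ℝ) ∈ V n := ((hVc n).mem_iff_infDist_zero (hVne n)).mpr hz
    obtain ⟨y, hy, hxy⟩ := this
    rw [Subtype.ext hxy] at hy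
    exact hy hx
  · intro j k hjk
    rw [hmap, hmap, ← cfc_mul _ _ _ (hfc j).continuousOn (hfc k).continuousOn,
      ← cfc_const_zero ℝ (π a)]
    refine cfc_congr fun t ht ↦ ?_
    by_cases htj : (⟨t, ht⟩ : spectrum ℝ (π a)) ∈ U j
    · have : t ∈ V k := ⟨⟨t, ht⟩, fun h ↦ Set.disjoint_left.mp (hUd hjk) htj h, rfl⟩
      simp [hf, Metric.infDist_zero_of_mem this]
    · have : t ∈ V j := ⟨⟨t, ht⟩, htj, rfl⟩
      simp [hf, Metric.infDist_zero_of_mem this]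

/-- A projection `p` in the range of `π` is minimal if `p B p = ℂ p`, where `B` is the range. -/
structure IsMinimalProjectionIn (π : A →⋆ₐ[ℂ] C) (p : C) : Prop where
  isStarProjection : IsStarProjection p
  mem_range : p ∈ π.range
  exists_smul : ∀ x : A, ∃ c : ℂ, p * π x * p = c • p

/-- Successive differences of the chain are nonzero and pairwise orthogonal. -/
theorem IsDerivationAlong.not_exists_descending (hd : IsDerivationAlong π d)
    (hπ : ∀ a : A, Continuous (fun x ↦ d (a * x)) → π a = 0) (p : ℕ → C)
    (hp : ∀ n, IsStarProjection (p n)) (hpr : ∀ n, p n ∈ π.range)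
    (hle : ∀ n, p n * p (n + 1) = p (n + 1)) (hne : ∀ n, p (n + 1) ≠ p n) : False := by
  have hmul : ∀ m n, m ≤ n → p m * p n = p n := by
    intro m n hmn
    induction n, hmn using Nat.le_induction with
    | base => exact (hp m).isIdempotentElem
    | succ n _ ih => rw [← hle n, ← mul_assoc, ih]
  have hmul' : ∀ m n, m ≤ n → p n * p m = p n := by
    intro m n hmn
    have := congrArg star (hmul m n hmn)
    rwa [star_mul, (hp m).isSelfAdjoint.star_eq, (hp n).isSelfAdjoint.star_eq] at this
  choose a ha using hpr
  have hmap : ∀ n, π (a n - a (n + 1)) = p n - p (n + 1) := fun n ↦ by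
    rw [map_sub]; exact congrArg₂ _ (ha n) (ha (n + 1))
  refine hd.not_exists_orthogonal hπ (fun n ↦ a n - a (n + 1)) ?_ ?_ ?_
  · intro n
    rw [hmap]
    exact (hp n).isSelfAdjoint.sub (hp (n + 1)).isSelfAdjoint
  · intro n h
    rw [hmap, sub_eq_zero] at h
    exact hne n h.symm
  · intro j k hjk
    rw [hmap, hmap, sub_mul, mul_sub, mul_sub]
    rcases lt_or_gt_of_ne hjk with h | h
    · rw [hmul j k h.le, hmul j (k + 1) (by lia), hmul (j + 1) k h, hmul (j + 1) (k + 1) (by lia)]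
      simp
    · rw [hmul' k j h.le, hmul' k (j + 1) (by lia), hmul' (k + 1) j h,
        hmul' (k + 1) (j + 1) (by lia)]
      simp

theorem StarAlgHom.cfc_mem_range_of_finite_spectrum {a : A} (ha : IsSelfAdjoint a)
    (hfin : (spectrum ℝ (π a)).Finite) (f : ℝ → ℝ) : cfc f (π a) ∈ π.range := by
  set P : Polynomial ℝ := Lagrange.interpolate hfin.toFinset id f
  refine ⟨cfc P.eval a, ?_⟩
  refine (π.map_cfc_of_isSelfAdjoint P.continuous ha).trans (cfc_congr fun t ht ↦ ?_)
  exact Lagrange.eval_interpolate_at_node (v := id) f Function.injective_id.injOn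
    (hfin.mem_toFinset.mpr ht)

/-- If `z = p z p` is self-adjoint with finite spectrum and is not a multiple of the projection `p`,
then some spectral projection of `z` splits `p`. -/
theorem IsStarProjection.exists_cfc_split {p z : C} (hp : IsStarProjection p)
    (hz : IsSelfAdjoint z) (hpz : p * z = z) (hfin : (spectrum ℝ z).Finite)
    (hns : ∀ c : ℂ, z ≠ c • p) :
    ∃ f : ℝ → ℝ, IsStarProjection (p * cfc f z) ∧ p * cfc f z ≠ 0 ∧ p * cfc f z ≠ p := by
  classical
  have hzp : z * p = z := by
    have := congrArg star hpz
    rwa [star_mul, hz.star_eq, hp.isSelfAdjoint.star_eq] at this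
  have hcomm : Commute z p := hzp.trans hpz.symm
  set e : ℝ → ℝ → ℝ := fun l t ↦ if t = l then 1 else 0 with he
  have hc : ∀ f : ℝ → ℝ, ContinuousOn f (spectrum ℝ z) := fun f ↦ hfin.continuousOn f
  have hproj : ∀ l, IsStarProjection (p * cfc (e l) z) := by
    intro l
    refine hp.mul ⟨?_, cfc_predicate (e l) z⟩ (hcomm.cfc_real (e l)).symm
    rw [IsIdempotentElem, ← cfc_mul _ _ z (hc _) (hc _)]
    congr 1
    ext t
    simp [he]
  -- If no spectral projection splits `p`, each `p * cfc (e l) z` is `0` or `p`, which makes `z = ∑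
  -- l • p * cfc (e l) z` a multiple of `p`.
  by_contra! h
  have h' : ∀ l, ∃ c : ℂ, p * cfc (e l) z = c • p := by
    intro l
    by_cases h0 : p * cfc (e l) z = 0
    · exact ⟨0, by simp [h0]⟩
    · exact ⟨1, by simp [h _ (hproj l) h0]⟩
  choose c hc' using h'
  have hsum : z = ∑ l ∈ hfin.toFinset, l • cfc (e l) z := by
    conv_lhs => rw [← cfc_id ℝ z]
    simp_rw [← cfc_smul _ _ z (hc _)]
    rw [← cfc_sum _ z _ fun l _ ↦ hc _]
    refine cfc_congr fun t ht ↦ ?_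
    simp [he, hfin.mem_toFinset.mpr ht]
  apply hns (∑ l ∈ hfin.toFinset, (l : ℂ) * c l)
  refine hpz.symm.trans ((congrArg (p * ·) hsum).trans ?_)
  rw [Finset.mul_sum, Finset.sum_smul]
  refine Finset.sum_congr rfl fun l _ ↦ ?_
  rw [mul_smul_comm, hc', mul_smul, RCLike.real_smul_eq_coe_smul (K := ℂ)]
  rfl

theorem IsDerivationAlong.exists_split (hd : IsDerivationAlong π d)
    (hπ : ∀ a : A, Continuous (fun x ↦ d (a * x)) → π a = 0) {p : C} (hp : IsStarProjection p)
    (hpr : p ∈ π.range) (hmin : ¬ IsMinimalProjectionIn π p) :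
    ∃ q, IsStarProjection q ∧ q ∈ π.range ∧ p * q = q ∧ q ≠ 0 ∧ q ≠ p := by
  have hx : ∃ x : A, IsSelfAdjoint x ∧ ∀ c : ℂ, p * π x * p ≠ c • p := by
    by_contra! h
    refine hmin ⟨hp, hpr, fun x ↦ ?_⟩
    obtain ⟨c, hc⟩ := h (realPart x) (realPart x).2
    obtain ⟨c', hc'⟩ := h (imaginaryPart x) (imaginaryPart x).2
    refine ⟨c + Complex.I * c', ?_⟩
    conv_lhs => rw [← realPart_add_I_smul_imaginaryPart x]
    rw [map_add, map_smul, mul_add, add_mul, hc, mul_smul_comm, smul_mul_assoc, hc', add_smul,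
      mul_smul]
  obtain ⟨x, hx, hns⟩ := hx
  obtain ⟨b, hb⟩ := hpr
  have hbp : π b = p := hb
  obtain ⟨a, ha, haz⟩ : ∃ a : A, IsSelfAdjoint a ∧ π a = p * π x * p := by
    refine ⟨star b * x * b, by simpa using hx.conjugate (star b), ?_⟩
    rw [map_mul, map_mul, map_star, hbp, hp.isSelfAdjoint.star_eq]
  have hpz : p * π a = π a := by rw [haz, ← mul_assoc, ← mul_assoc, hp.isIdempotentElem]
  have hfin := hd.finite_spectrum hπ ha
  obtain ⟨f, hf, hf0, hfp⟩ := hp.exists_cfc_split (ha.map π) hpz hfin (by rwa [haz])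
  refine ⟨_, hf, mul_mem ⟨b, hb⟩ (StarAlgHom.cfc_mem_range_of_finite_spectrum ha hfin f), ?_,
    hf0, hfp⟩
  rw [← mul_assoc, hp.isIdempotentElem]

/-- A projection outside the span is not minimal, so it splits, and one of the two pieces is again
outside. Iterating from `1` gives a forbidden descending chain. -/
theorem IsDerivationAlong.one_mem_span_minimal (hd : IsDerivationAlong π d)
    (hπ : ∀ a : A, Continuous (fun x ↦ d (a * x)) → π a = 0) :
    (1 : C) ∈ Submodule.span ℂ {p | IsMinimalProjectionIn π p} := by
  set M := Submodule.span ℂ {p | IsMinimalProjectionIn π p}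
  by_contra h1
  let X := {p : C // IsStarProjection p ∧ p ∈ π.range ∧ p ∉ M}
  have step : ∀ p : X, ∃ q : X, p.1 * q.1 = q.1 ∧ q.1 ≠ p.1 := by
    rintro ⟨p, hp, hpr, hpM⟩
    obtain ⟨q, hq, hqr, hpq, hq0, hqp⟩ := hd.exists_split hπ hp hpr
      fun h ↦ hpM (Submodule.subset_span h)
    by_cases hqM : q ∈ M
    · refine ⟨⟨p - q, hq.sub_of_mul_eq_right hp hpq, sub_mem hpr hqr,
        fun h ↦ hpM (by simpa using add_mem h hqM)⟩, ?_, ?_⟩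
      · change p * (p - q) = p - q
        rw [mul_sub, hp.isIdempotentElem, hpq]
      · simpa using hq0
    · exact ⟨⟨q, hq, hqr, hqM⟩, hpq, hqp⟩
  choose next hnext using step
  let s : ℕ → X := fun n ↦ next^[n] ⟨1, .one C, one_mem _, h1⟩
  have hs : ∀ n, s (n + 1) = next (s n) := fun n ↦ Function.iterate_succ_apply' _ _ _
  refine hd.not_exists_descending hπ (fun n ↦ (s n).1) (fun n ↦ (s n).2.1) (fun n ↦ (s n).2.2.1)
    (fun n ↦ ?_) (fun n ↦ ?_)
  · rw [hs]; exact (hnext _).1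
  · rw [hs]; exact (hnext _).2

/-- For a nonzero corner element `π w`, minimality makes `π w * star (π w)` a nonzero multiple of
`p` and `star (π w) * (p * π x * q)` a multiple of `q`; multiply the latter by `π w`. -/
theorem IsMinimalProjectionIn.exists_corner_eq_smul {p q : C} (hp : IsMinimalProjectionIn π p)
    (hq : IsMinimalProjectionIn π q) :
    ∃ w : A, ∀ x : A, ∃ c : ℂ, p * π x * q = c • π w := by
  by_cases h : ∀ x, p * π x * q = 0
  · exact ⟨0, fun x ↦ ⟨0, by simp [h x]⟩⟩
  push Not at h
  obtain ⟨x₀, hx₀⟩ := h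
  obtain ⟨w, hw⟩ : ∃ w, π w = p * π x₀ * q := by
    obtain ⟨a, ha⟩ := hp.mem_range
    obtain ⟨b, hb⟩ := hq.mem_range
    exact ⟨a * x₀ * b, by rw [map_mul, map_mul]; exact congrArg₂ (fun s t ↦ s * π x₀ * t) ha hb⟩
  have hpp : p * p = p := hp.isStarProjection.isIdempotentElem
  have hqq : q * q = q := hq.isStarProjection.isIdempotentElem
  have hps : star p = p := hp.isStarProjection.isSelfAdjoint
  have hqs : star q = q := hq.isStarProjection.isSelfAdjoint
  obtain ⟨b, hb⟩ : ∃ b, π b = q := hq.mem_range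
  obtain ⟨a, ha⟩ : ∃ a, π a = p := hp.mem_range
  have hwq : π w * q = π w := by rw [hw, mul_assoc, hqq]
  have hws : star (π w) = q * π (star x₀) * p := by
    rw [hw, star_mul, star_mul, hps, hqs, map_star, mul_assoc]
  obtain ⟨c, hc⟩ := hp.exists_smul (x₀ * b * star x₀)
  have hcc : π w * star (π w) = c • p := by
    rw [← hc, hws, hw, map_mul, map_mul, hb]
    simp only [mul_assoc]
    rw [← mul_assoc q q, hqq]
  have hc0 : c ≠ 0 := by
    rintro rfl
    rw [zero_smul, CStarRing.mul_star_self_eq_zero_iff] at hcc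
    exact hx₀ (hw ▸ hcc)
  refine ⟨w, fun x ↦ ?_⟩
  obtain ⟨k, hk⟩ := hq.exists_smul (star x₀ * a * x)
  have hkk : star (π w) * (p * π x * q) = k • q := by
    rw [← hk, hws, map_mul, map_mul, ha]
    simp only [mul_assoc]
    rw [← mul_assoc p p, hpp]
  refine ⟨c⁻¹ * k, ?_⟩
  rw [mul_smul, eq_inv_smul_iff₀ hc0]
  calc c • (p * π x * q) = (c • p) * (p * π x * q) := by
        rw [smul_mul_assoc, ← mul_assoc, ← mul_assoc, hpp]
    _ = k • π w := by rw [← hcc, mul_assoc, hkk, mul_smul_comm, hwq]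

theorem IsDerivationAlong.continuous_corner (hd : IsDerivationAlong π d) {a b : A}
    (ha : IsMinimalProjectionIn π (π a)) (hb : IsMinimalProjectionIn π (π b)) :
    Continuous fun x ↦ d (a * x * b) := by
  obtain ⟨w, hw⟩ := ha.exists_corner_eq_smul hb
  by_cases h0 : π w = 0
  · have : ∀ x, d (a * x * b) = 0 := fun x ↦ hd.eq_zero (by
      obtain ⟨c, hc⟩ := hw x
      rw [map_mul, map_mul, hc, h0, smul_zero])
    simp only [this, continuous_const]
  have hpos : 0 < ‖π w‖ := norm_pos_iff.mpr h0
  refine AddMonoidHomClass.continuous_of_bound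
    (d ∘ₗ LinearMap.mulRight ℂ b ∘ₗ LinearMap.mulLeft ℂ a) (‖a‖ * ‖b‖ / ‖π w‖ * ‖d w‖) fun x ↦ ?_
  obtain ⟨c, hc⟩ := hw x
  have hdx : d (a * x * b) = c • d w := by
    rw [← map_smul]
    exact hd.eq_of_map_eq (by rw [map_mul, map_mul, hc, map_smul])
  have hcn : ‖c‖ ≤ ‖a‖ * ‖x‖ * ‖b‖ / ‖π w‖ := by
    rw [le_div_iff₀ hpos, ← norm_smul, ← hc, ← map_mul, ← map_mul]
    refine (NonUnitalStarAlgHom.norm_apply_le π _).trans ((norm_mul_le _ _).trans ?_)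
    gcongr
    exact norm_mul_le _ _
  change ‖d (a * x * b)‖ ≤ _
  rw [hdx, norm_smul]
  calc ‖c‖ * ‖d w‖ ≤ ‖a‖ * ‖x‖ * ‖b‖ / ‖π w‖ * ‖d w‖ := by gcongr
    _ = _ := by ring

/-- A derivation `d` along a unital `*`-homomorphism `π` of C*-algebras is continuous, provided
that `π` vanishes at every `a` for which `x ↦ d (a x)` is continuous. -/
theorem IsDerivationAlong.continuous_of_starAlgHom (hd : IsDerivationAlong π d)
    (hπ : ∀ a : A, Continuous (fun x ↦ d (a * x)) → π a = 0) : Continuous d := by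
  set N := Submodule.span ℂ {a : A | IsMinimalProjectionIn π (π a)}
  have hcont : ∀ a ∈ N, ∀ b ∈ N, Continuous fun x ↦ d (a * x * b) := by
    intro a ha b hb
    induction ha, hb using Submodule.span_induction₂ with
    | mem_mem a b ha hb => exact hd.continuous_corner ha hb
    | zero_left b _ => simpa using continuous_const
    | zero_right a _ => simpa using continuous_const
    | add_left a a' b _ _ _ h h' =>
      simp only [add_mul, map_add]
      exact h.add h'
    | add_right a b b' _ _ _ h h' =>
      simp only [mul_add, map_add]
      exact h.add h'
    | smul_left r a b _ _ h =>
      simp only [smul_mul_assoc, map_smul]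
      exact h.const_smul r
    | smul_right r a b _ _ h =>
      simp only [mul_smul_comm, map_smul]
      exact h.const_smul r
  have hmem : (1 : C) ∈ N.map π.toLinearMap := by
    rw [Submodule.map_span]
    refine Submodule.span_mono ?_ (hd.one_mem_span_minimal hπ)
    intro p hp
    obtain ⟨a, ha⟩ : ∃ a, π a = p := hp.mem_range
    exact ⟨a, by simpa [ha] using hp, ha⟩
  obtain ⟨a, haN, ha⟩ := hmem
  have ha1 : π a = 1 := ha
  refine (hcont a haN a haN).congr fun x ↦ hd.eq_of_map_eq ?_
  rw [map_mul, map_mul, ha1, one_mul, mul_one]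

end StarHom

/-! ### The separating space -/

section SeparatingSpace

variable {A B : Type*} [NormedRing A] [NormedSpace ℂ A] [NormedRing B] [NormedSpace ℂ B]

/-- The separating space of a linear map `D`: the limits of `D x` along sequences `x → 0`. -/
def separatingSpace (D : A →ₗ[ℂ] B) : Set B :=
  {T | ∃ x : ℕ → A, Tendsto x atTop (𝓝 0) ∧ Tendsto (fun n ↦ D (x n)) atTop (𝓝 T)}

variable {D S : A →ₗ[ℂ] B} {T : B}

theorem continuous_of_separatingSpace_eq_zero [CompleteSpace A] [CompleteSpace B]
    (h : ∀ T ∈ separatingSpace D, T = 0) : Continuous D := by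
  refine LinearMap.continuous_of_seq_closed_graph D fun u x y hu hy ↦ ?_
  rw [← sub_eq_zero]
  refine h _ ⟨fun n ↦ u n - x, by simpa using hu.sub_const x, ?_⟩
  simpa using hy.sub_const (D x)

theorem star_mem_separatingSpace [StarRing A] [NormedStarGroup A] [StarRing B] [NormedStarGroup B]
    (hD : IsStarMapping D) (hT : T ∈ separatingSpace D) : star T ∈ separatingSpace D := by
  obtain ⟨x, hx, hxT⟩ := hT
  refine ⟨fun n ↦ star (x n), by simpa using hx.star, ?_⟩
  have := hxT.star
  simpa only [← hD _] using this

theorem IsDerivationAlong.tendsto_mul_left (hd : IsDerivationAlong S D) (hS : IsContinuousRel S D)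
    (a : A) {x : ℕ → A} (hx : Tendsto x atTop (𝓝 0)) (hxT : Tendsto (fun n ↦ D (x n)) atTop (𝓝 T)) :
    Tendsto (fun n ↦ D (a * x n)) atTop (𝓝 (S a * T)) := by
  have h := (hxT.const_mul (S a)).add ((hS.2 a).comp hx)
  rw [add_zero] at h
  exact h.congr fun n ↦ (hd a (x n)).symm

theorem IsDerivationAlong.mul_mem_separatingSpace (hd : IsDerivationAlong S D)
    (hS : IsContinuousRel S D) (a : A) (hT : T ∈ separatingSpace D) :
    S a * T ∈ separatingSpace D := by
  obtain ⟨x, hx, hxT⟩ := hT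
  exact ⟨fun n ↦ a * x n, by simpa using hx.const_mul a, hd.tendsto_mul_left hS a hx hxT⟩

theorem IsDerivationAlong.map_one_mul_of_mem_separatingSpace (hd : IsDerivationAlong S D)
    (hS : IsContinuousRel S D) (hT : T ∈ separatingSpace D) : S 1 * T = T := by
  obtain ⟨x, hx, hxT⟩ := hT
  refine tendsto_nhds_unique (hd.tendsto_mul_left hS 1 hx hxT) ?_
  simpa using hxT

/-- Both sides are the limit of `D (a b xₙ)`. -/
theorem IsDerivationAlong.map_mul_mul_of_mem_separatingSpace (hd : IsDerivationAlong S D)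
    (hS : IsContinuousRel S D) (a b : A) (hT : T ∈ separatingSpace D) :
    S (a * b) * T = S a * (S b * T) := by
  obtain ⟨x, hx, hxT⟩ := hT
  have h1 := hd.tendsto_mul_left hS (a * b) hx hxT
  have h2 := hd.tendsto_mul_left hS a (by simpa using hx.const_mul b)
    (hd.tendsto_mul_left hS b hx hxT)
  refine tendsto_nhds_unique h1 (h2.congr fun n ↦ ?_)
  rw [mul_assoc]

end SeparatingSpace

/-! ### Restriction and compression to the separating subspace -/

section Hilbert

variable {A 𝔥 : Type*} [CStarAlgebra A] [NormedAddCommGroup 𝔥] [InnerProductSpace ℂ 𝔥]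
  [CompleteSpace 𝔥] {D S : A →ₗ[ℂ] (𝔥 →L[ℂ] 𝔥)}

/-- The closed linear span of the ranges of the operators in the separating space of `D`. -/
noncomputable def separatingSubspace (D : A →ₗ[ℂ] (𝔥 →L[ℂ] 𝔥)) : Submodule ℂ 𝔥 :=
  (Submodule.span ℂ {k | ∃ T ∈ separatingSpace D, ∃ h, T h = k}).topologicalClosure

instance (D : A →ₗ[ℂ] (𝔥 →L[ℂ] 𝔥)) : CompleteSpace (separatingSubspace D) :=
  (Submodule.isClosed_topologicalClosure _).completeSpace_coe

theorem apply_mem_separatingSubspace {T : 𝔥 →L[ℂ] 𝔥} (hT : T ∈ separatingSpace D) (h : 𝔥) :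
    T h ∈ separatingSubspace D :=
  Submodule.le_topologicalClosure _ (Submodule.subset_span ⟨T, hT, h, rfl⟩)

theorem separatingSubspace_le {L : Submodule ℂ 𝔥} (hL : IsClosed (L : Set 𝔥))
    (h : ∀ T ∈ separatingSpace D, ∀ x, T x ∈ L) : separatingSubspace D ≤ L := by
  refine Submodule.topologicalClosure_minimal _ (Submodule.span_le.mpr ?_) hL
  rintro _ ⟨T, hT, x, rfl⟩
  exact h T hT x

theorem eq_on_separatingSubspace {U V : 𝔥 →L[ℂ] 𝔥}
    (h : ∀ T ∈ separatingSpace D, U * T = V * T) {k : 𝔥} (hk : k ∈ separatingSubspace D) :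
    U k = V k := by
  have : separatingSubspace D ≤ LinearMap.ker (U - V).toLinearMap :=
    separatingSubspace_le (U - V).isClosed_ker fun T hT x ↦ by
      simpa [sub_eq_zero] using DFunLike.congr_fun (h T hT) x
  simpa [sub_eq_zero] using this hk

theorem IsDerivationAlong.map_mem_separatingSubspace (hd : IsDerivationAlong S D)
    (hS : IsContinuousRel S D) (a : A) : ∀ k ∈ separatingSubspace D, S a k ∈ separatingSubspace D :=
  separatingSubspace_le (L := (separatingSubspace D).comap (S a).toLinearMap)
    ((Submodule.isClosed_topologicalClosure _).preimage (S a).continuous)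
    fun _ hT x ↦ apply_mem_separatingSubspace (hd.mul_mem_separatingSpace hS a hT) x

/-- The restriction of `S` to the separating subspace of `D`, as a `*`-homomorphism. -/
noncomputable def restrictSeparating (hd : IsDerivationAlong S D) (hS : IsContinuousRel S D)
    (hSstar : IsStarMapping S) :
    A →⋆ₐ[ℂ] (separatingSubspace D →L[ℂ] separatingSubspace D) :=
  let r : A →ₗ[ℂ] (separatingSubspace D →L[ℂ] separatingSubspace D) :=
    { toFun := fun a ↦ (S a).restrict (hd.map_mem_separatingSubspace hS a)
      map_add' := fun a b ↦ by ext k; simp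
      map_smul' := fun c a ↦ by ext k; simp }
  { AlgHom.ofLinearMap r
      (by
        ext k
        exact eq_on_separatingSubspace (U := S 1) (V := 1) (fun T hT ↦ by
          rw [hd.map_one_mul_of_mem_separatingSpace hS hT, one_mul]) k.2)
      (fun a b ↦ by
        ext k
        exact eq_on_separatingSubspace (U := S (a * b)) (V := S a * S b) (fun T hT ↦ by
          rw [hd.map_mul_mul_of_mem_separatingSpace hS a b hT, mul_assoc]) k.2) with
    map_star' := fun a ↦ by
      refine ContinuousLinearMap.eq_adjoint_iff _ _ |>.mpr fun x y ↦ ?_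
      change inner ℂ (S (star a) x) (y : 𝔥) = inner ℂ (x : 𝔥) (S a y)
      rw [hSstar a, ContinuousLinearMap.star_eq_adjoint, ContinuousLinearMap.adjoint_inner_left] }

theorem coe_restrictSeparating_apply (hd : IsDerivationAlong S D) (hS : IsContinuousRel S D)
    (hSstar : IsStarMapping S) (a : A) (k : separatingSubspace D) :
    (restrictSeparating hd hS hSstar a k : 𝔥) = S a k := rfl

/-- The compression of operators on `𝔥` to a subspace `K`. -/
noncomputable def Submodule.compression (K : Submodule ℂ 𝔥) [K.HasOrthogonalProjection] :
    (𝔥 →L[ℂ] 𝔥) →L[ℂ] (K →L[ℂ] K) :=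
  (ContinuousLinearMap.compL ℂ K 𝔥 K K.orthogonalProjectionOnto) ∘L
    ((ContinuousLinearMap.compL ℂ K 𝔥 𝔥).flip K.subtypeL)

theorem Submodule.compression_apply (K : Submodule ℂ 𝔥) [K.HasOrthogonalProjection]
    (T : 𝔥 →L[ℂ] 𝔥) (k : K) : K.compression T k = K.orthogonalProjectionOnto (T k) := rfl

/-- The subspace is invariant under `S (star a) = star (S a)` too, so it reduces `S a`. -/
theorem IsDerivationAlong.orthogonalProjectionOnto_map (hd : IsDerivationAlong S D)
    (hS : IsContinuousRel S D) (hSstar : IsStarMapping S) (a : A) (h : 𝔥) :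
    (separatingSubspace D).orthogonalProjectionOnto (S a h) =
      restrictSeparating hd hS hSstar a ((separatingSubspace D).orthogonalProjectionOnto h) := by
  refine Subtype.ext (Submodule.eq_starProjection_of_mem_of_inner_eq_zero (Subtype.prop _) ?_)
  intro w hw
  rw [coe_restrictSeparating_apply, ← map_sub, ← ContinuousLinearMap.adjoint_inner_right,
    ← ContinuousLinearMap.star_eq_adjoint, ← hSstar]
  exact Submodule.starProjection_inner_eq_zero _ _ (hd.map_mem_separatingSubspace hS _ _ hw)

theorem IsDerivationAlong.compression (hd : IsDerivationAlong S D)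
    (hS : IsContinuousRel S D) (hSstar : IsStarMapping S) :
    IsDerivationAlong (restrictSeparating hd hS hSstar)
      ((separatingSubspace D).compression.toLinearMap ∘ₗ D) := by
  intro a b
  ext k
  simp only [LinearMap.comp_apply, ContinuousLinearMap.coe_coe, hd a b]
  rw [map_add, _root_.add_apply, _root_.add_apply]
  congr 2
  exact hd.orthogonalProjectionOnto_map hS hSstar a _

theorem apply_eq_zero_of_mem_orthogonal (hDstar : IsStarMapping D) {T : 𝔥 →L[ℂ] 𝔥}
    (hT : T ∈ separatingSpace D) {h : 𝔥} (hh : h ∈ (separatingSubspace D)ᗮ) : T h = 0 := by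
  refine ext_inner_left ℂ fun u ↦ ?_
  rw [← ContinuousLinearMap.adjoint_inner_left, inner_zero_right]
  exact hh _ (apply_mem_separatingSubspace (star_mem_separatingSpace hDstar hT) u)

/-- `T` maps into the subspace and, since `star T` does as well, vanishes on its orthogonal
complement. -/
theorem eq_zero_of_compression_eq_zero (hDstar : IsStarMapping D) {T : 𝔥 →L[ℂ] 𝔥}
    (hT : T ∈ separatingSpace D) (h0 : (separatingSubspace D).compression T = 0) : T = 0 := by
  ext h
  have hsub : T h = T ((separatingSubspace D).orthogonalProjectionOnto h : 𝔥) := by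
    rw [← sub_eq_zero, ← map_sub]
    exact apply_eq_zero_of_mem_orthogonal hDstar hT (Submodule.sub_starProjection_mem_orthogonal h)
  have := congrArg Subtype.val
    (DFunLike.congr_fun h0 ((separatingSubspace D).orthogonalProjectionOnto h))
  rw [Submodule.compression_apply, ← hsub] at this
  rw [← Submodule.starProjection_eq_self_iff.mpr (apply_mem_separatingSubspace hT h)]
  exact this

/-- A `*`-derivation of a unital C*-algebra into `B(𝔥)` along a linear `*`-mapping `S` is
continuous if `S` is `D`-continuous. -/
theorem IsDerivationAlong.continuous_of_isContinuousRel (hd : IsDerivationAlong S D)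
    (hDstar : IsStarMapping D) (hSstar : IsStarMapping S) (hS : IsContinuousRel S D) :
    Continuous D := by
  set d := (separatingSubspace D).compression.toLinearMap ∘ₗ D with hd_def
  have hlim : ∀ {x : ℕ → A} {T}, Tendsto (fun n ↦ D (x n)) atTop (𝓝 T) →
      Tendsto (fun n ↦ d (x n)) atTop (𝓝 ((separatingSubspace D).compression T)) := fun h ↦
    ((separatingSubspace D).compression.continuous.tendsto _).comp h
  have hcont : Continuous d := by
    refine IsDerivationAlong.continuous_of_starAlgHom
      (C := separatingSubspace D →L[ℂ] separatingSubspace D) (d := d)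
      (hd.compression hS hSstar) fun a ha ↦ ?_
    ext k
    refine eq_on_separatingSubspace (U := S a) (V := 0) (fun T hT ↦ ?_) k.2
    rw [zero_mul]
    refine eq_zero_of_compression_eq_zero hDstar (hd.mul_mem_separatingSpace hS a hT) ?_
    obtain ⟨x, hx, hxT⟩ := hT
    refine tendsto_nhds_unique (hlim (hd.tendsto_mul_left hS a hx hxT)) ?_
    simpa [Function.comp_def] using (ha.tendsto 0).comp hx
  refine continuous_of_separatingSpace_eq_zero fun T hT ↦ ?_
  refine eq_zero_of_compression_eq_zero hDstar hT ?_
  obtain ⟨x, hx, hxT⟩ := hT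
  refine tendsto_nhds_unique (hlim hxT) ?_
  simpa [Function.comp_def] using (hcont.tendsto 0).comp hx

/-- If `D (a b) = U a D b + D a V b` for all `a`, `b` with `*`-mappings `D`, `U`, `V` for which `U + V` is
`D`-continuous, then `D` is continuous. -/
theorem continuous_of_map_mul_eq {U V : A →ₗ[ℂ] (𝔥 →L[ℂ] 𝔥)}
    (hD : IsStarMapping D) (hU : IsStarMapping U) (hV : IsStarMapping V)
    (hmul : ∀ a b, D (a * b) = U a * D b + D a * V b)
    (hUV : IsContinuousRel (fun a ↦ U a + V a) D) : Continuous D := by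
  have hmul' : ∀ a b, D (a * b) = D a * U b + V a * D b := fun a b ↦ by
    have h := congrArg star (hmul (star b) (star a))
    rw [← hD, star_mul, star_star, star_star, star_add, star_mul, star_mul, ← hD, ← hD, ← hU,
      ← hV] at h
    simpa only [star_star] using h
  have happ : ∀ a, ((2⁻¹ : ℂ) • (U + V)) a = (2⁻¹ : ℂ) • (U a + V a) := fun a ↦ rfl
  refine IsDerivationAlong.continuous_of_isContinuousRel (S := (2⁻¹ : ℂ) • (U + V))
    (fun a b ↦ ?_) hD (fun a ↦ ?_) ⟨fun b ↦ ?_, fun b ↦ ?_⟩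
  · have h2 : D (a * b) = (2⁻¹ : ℂ) • (D (a * b) + D (a * b)) := by
      rw [← two_smul ℂ, smul_smul]; norm_num
    rw [h2, happ, happ]
    nth_rewrite 1 [hmul a b]
    rw [hmul' a b, smul_mul_assoc, mul_smul_comm, ← smul_add, add_mul, mul_add]
    congr 1
    abel
  · rw [happ, happ, star_smul, star_add, hU, hV]
    simp
  · simpa only [happ, smul_mul_assoc, smul_zero] using (hUV.1 b).const_smul (2⁻¹ : ℂ)
  · simpa only [happ, mul_smul_comm, smul_zero] using (hUV.2 b).const_smul (2⁻¹ : ℂ)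

end Hilbert

end Auxiliary

/-! ### Reduction of the theorem to a two-map Leibniz rule -/

theorem mainTheorem1 {𝔥 : Type*} [NormedAddCommGroup 𝔥] [InnerProductSpace ℂ 𝔥] [CompleteSpace 𝔥]
    (𝒜 : StarSubalgebra ℂ (𝔥 →L[ℂ] 𝔥)) (h𝒜 : IsClosed (𝒜 : Set (𝔥 →L[ℂ] 𝔥)))
    (D E F G H : 𝒜 →ₗ[ℂ] (𝔥 →L[ℂ] 𝔥)) (hD : IsStarEFGHDerivation D E F G H) :
    (E 1 = 1 → H 1 = 1 →
      (∀ a b : 𝒜, H a * D 1 * E b = -(E a * D 1 * H b)) →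
      IsContinuousRel (fun a : 𝒜 => E a + H a) (fun a : 𝒜 => D a) →
      Continuous D) ∧
    (F 1 = 1 → G 1 = 1 →
      (∀ a b : 𝒜, G a * D 1 * F b = -(F a * D 1 * G b)) →
      IsContinuousRel (fun a : 𝒜 => F a + G a) (fun a : 𝒜 => D a) →
      Continuous D) := by
  let _ : CStarAlgebra 𝒜 := StarSubalgebra.cstarAlgebra 𝒜 (h_closed := h𝒜)
  have hzero : D 1 = -D 1 → D 1 = 0 := fun h ↦ by
    have h2 : (2 : ℂ) • D 1 = 0 := by rw [two_smul]; nth_rewrite 1 [h]; exact neg_add_cancel _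
    exact (smul_eq_zero_iff_right two_ne_zero).mp h2
  have hmul := hD.derivation
  have hleft : ∀ b, D b = E 1 * F b + G 1 * H b := fun b ↦ by simpa using hmul 1 b
  have hright : ∀ a, D a = E a * F 1 + G a * H 1 := fun a ↦ by simpa using hmul a 1
  refine ⟨fun hE hH h hcont ↦ ?_, fun hF hG h hcont ↦ ?_⟩
  · have h1 : D 1 = 0 := hzero (by simpa [hE, hH] using h 1 1)
    refine continuous_of_map_mul_eq hD.star_D hD.star_E hD.star_H (fun a b ↦ ?_) hcont
    -- Now `F b = D b + F 1 * H b` and `G a = D a - E a * F 1`; on substitution the terms `E a * F 1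
    -- * H b` cancel.
    have hsum : F 1 + G 1 = 0 := by rw [← h1, hleft, hE, hH, one_mul, mul_one]
    have hG : G 1 = -F 1 := eq_neg_of_add_eq_zero_right hsum
    rw [hmul, hleft b, hright a, hE, hH, hG]
    noncomm_ring
  · have h1 : D 1 = 0 := hzero (by simpa [hF, hG] using h 1 1)
    refine continuous_of_map_mul_eq hD.star_D hD.star_G hD.star_F (fun a b ↦ ?_)
      (by simpa only [add_comm] using hcont)
    have hsum : E 1 + H 1 = 0 := by rw [← h1, hleft, hF, hG, one_mul, mul_one]
    have hH : H 1 = -E 1 := eq_neg_of_add_eq_zero_right hsum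
    rw [hmul, hleft b, hright a, hF, hG, hH]
    noncomm_ring
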